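/- Let $n,m,p,l\ge 0$ be integers and let $f,g_i,h_j,G_k,H_k:\mathbb{R}^n\to\mathbb{R}$ ($1\le i\le m$, $1\le j\le p$, $1\le k\le l$) be twice continuously differentiable. Consider the mathematical program with switching constraints $$\text{(MPSC)}\qquad \min f(x)\quad\text{s.t.}\quad g_i(x)\le 0,\quad h_j(x)=0,\quad G_k(x)H_k(x)=0,$$ with feasible set $\mathcal F$, and write $$r(x):=\Big(\sum_{i=1}^m [\max\{g_i(x),0\}]^2+\sum_{j=1}^p [h_j(x)]^2+\sum_{k=1}^l\min\{[G_k(x)]^2,[H_k(x)]^2\}\Big)^{1/2}.$$ Fix $\bar x\in\mathcal F$ and put $\mathcal I_g=\{i: g_i(\bar x)=0\}$, $\mathcal I_G=\{k: G_k(\bar x)=0\ne H_k(\bar x)\}$, $\mathcal I_H=\{k: G_k(\bar x)\neq 0=H_k(\bar x)\}$, $\mathcal I_{GH}=\{k: G_k(\bar x)=H_k(\bar x)=0\}$. Assume that MPSC piecewise constant rank of subspace component (MPSC-PCRSC) holds at $\bar x$: for every pair $(\beta_1,\beta_2)$ of disjoint (possibly empty) sets with $\beta_1\cup\beta_2=\mathcal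 I_{GH}$ there is $\varepsilon>0$ such that the rank of the family $$\{\nabla g_i(x)\}_{i\in\mathcal I_g^-}\cup\{\nabla h_j(x)\}_{1\le j\le p}\cup\{\nabla G_k(x)\}_{k\in\mathcal I_G\cup\beta_1}\cup\{\nabla H_k(x)\}_{k\in\mathcal I_H\cup\beta_2}$$ is the same for all $x$ with $\|x-\bar x\|<\varepsilon$, where $\mathcal I_g^-$ (which depends on $(\beta_1,\beta_2)$) is the set of those $i_0\in\mathcal I_g$ for which there are reals $\lambda_i\ge 0$ and $\rho_j,\mu_k,\nu_k\in\mathbb{R}$ with $$-\nabla g_{i_0}(\bar x)=\sum_{i\in\mathcal I_g\setminus\{i_0\}}\lambda_i\nabla g_i(\bar x)+\sum_{j=1}^p\rho_j\nabla h_j(\bar x)+\sum_{k\in\mathcal I_G\cup\beta_1}\mu_k\nabla G_k(\bar x)+\sum_{k\in\mathcal I_H\cup\beta_2}\nu_k\nabla H_k(\bar x).$$ Then the local error bound of (MPSC) holds at $\bar x$: there are $\varepsilon,\alpha>0$ such that $$\operatorname{dist}(x,\mathcal F)\le \alpha\, r(x)\qquad\text{for all } x \text{ with } \|x-\bar x\|<\varepsilon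 .$$ If moreover $\bar x$ is a locally optimal solution of (MPSC), then the penalty problem $\min_{x\in\mathbb{R}^n} f(x)+\kappa\, r(x)$ admits a local exact penalization at $\bar x$: there is $\bar\kappa>0$ such that $\bar x$ is a local minimizer of $f+\kappa r$ for every $\kappa>\bar\kappa$. More precisely, whenever the error bound holds near $\bar x$ with a constant $\alpha>0$ and $f$ is Lipschitz near $\bar x$ with constant $L_f\ge 0$, the point $\bar x$ is a local minimizer of $f+\kappa r$ for every $\kappa>\alpha L_f$. -/

import Mathlib

open scoped BigOperators NNReal

/-- A mathematical program with switching constraints on `ℝⁿ`: minimize `f x` subject to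
`g i x ≤ 0`, `h j x = 0`, `G k x * H k x = 0`, with twice continuously differentiable data. -/
structure MPSC (n m p l : ℕ) where
  f : EuclideanSpace ℝ (Fin n) → ℝ
  g : Fin m → EuclideanSpace ℝ (Fin n) → ℝ
  h : Fin p → EuclideanSpace ℝ (Fin n) → ℝ
  G : Fin l → EuclideanSpace ℝ (Fin n) → ℝ
  H : Fin l → EuclideanSpace ℝ (Fin n) → ℝ
  contDiff_f : ContDiff ℝ 2 f
  contDiff_g : ∀ i, ContDiff ℝ 2 (g i)
  contDiff_h : ∀ j, ContDiff ℝ 2 (h j)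
  contDiff_G : ∀ k, ContDiff ℝ 2 (G k)
  contDiff_H : ∀ k, ContDiff ℝ 2 (H k)

namespace MPSC

variable {n m p l : ℕ}

/-- The feasible set. -/
def feasible (P : MPSC n m p l) : Set (EuclideanSpace ℝ (Fin n)) :=
  {x | (∀ i, P.g i x ≤ 0) ∧ (∀ j, P.h j x = 0) ∧ (∀ k, P.G k x * P.H k x = 0)}

open Classical in
/-- Active inequality constraints `I_g`. -/
noncomputable def activeIneq (P : MPSC n m p l) (xbar : EuclideanSpace ℝ (Fin n)) :
    Finset (Fin m) :=
  Finset.univ.filter fun i => P.g i xbar = 0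

open Classical in
/-- The index set `I_G`: only `G k` vanishes. -/
noncomputable def idxG (P : MPSC n m p l) (xbar : EuclideanSpace ℝ (Fin n)) :
    Finset (Fin l) :=
  Finset.univ.filter fun k => P.G k xbar = 0 ∧ P.H k xbar ≠ 0

open Classical in
/-- The index set `I_H`: only `H k` vanishes. -/
noncomputable def idxH (P : MPSC n m p l) (xbar : EuclideanSpace ℝ (Fin n)) :
    Finset (Fin l) :=
  Finset.univ.filter fun k => P.G k xbar ≠ 0 ∧ P.H k xbar = 0

open Classical in
/-- The biactive index set `I_GH`: both `G k` and `H k` vanish. -/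
noncomputable def idxGH (P : MPSC n m p l) (xbar : EuclideanSpace ℝ (Fin n)) :
    Finset (Fin l) :=
  Finset.univ.filter fun k => P.G k xbar = 0 ∧ P.H k xbar = 0

/-- `(β₁, β₂)` is a disjoint bipartition of `I_GH` (empty parts are allowed). -/
def IsBipartition (P : MPSC n m p l) (xbar : EuclideanSpace ℝ (Fin n))
    (β₁ β₂ : Finset (Fin l)) : Prop :=
  Disjoint β₁ β₂ ∧ β₁ ∪ β₂ = P.idxGH xbar

/-- The subspace component `I_g⁻` of the branch problem given by `(β₁, β₂)`: the active indices
`i₀` such that `-∇ g_{i₀}(xbar)` is a combination of the other gradients of the branch problem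
that are active at `xbar`, with nonnegative coefficients on the inequality constraints. -/
def subspaceComponent (P : MPSC n m p l) (xbar : EuclideanSpace ℝ (Fin n))
    (β₁ β₂ : Finset (Fin l)) : Set (Fin m) :=
  {i₀ | i₀ ∈ P.activeIneq xbar ∧
    ∃ (lam : Fin m → ℝ) (rho : Fin p → ℝ) (mu nu : Fin l → ℝ),
      (∀ i ∈ P.activeIneq xbar, 0 ≤ lam i) ∧
      -gradient (P.g i₀) xbar =
        (∑ i ∈ (P.activeIneq xbar).erase i₀, lam i • gradient (P.g i) xbar)
        + (∑ j, rho j • gradient (P.h j) xbar)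
        + (∑ k ∈ P.idxG xbar ∪ β₁, mu k • gradient (P.G k) xbar)
        + (∑ k ∈ P.idxH xbar ∪ β₂, nu k • gradient (P.H k) xbar)}

/-- The family of gradients at `x` occurring in the constant rank condition for the branch
`(β₁, β₂)`; the index sets are those of the reference point `xbar`. -/
def branchGradients (P : MPSC n m p l) (xbar : EuclideanSpace ℝ (Fin n))
    (β₁ β₂ : Finset (Fin l)) (x : EuclideanSpace ℝ (Fin n)) :
    Set (EuclideanSpace ℝ (Fin n)) :=
  {v | ∃ i ∈ P.subspaceComponent xbar β₁ β₂, v = gradient (P.g i) x}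
  ∪ {v | ∃ j, v = gradient (P.h j) x}
  ∪ {v | ∃ k ∈ P.idxG xbar ∪ β₁, v = gradient (P.G k) x}
  ∪ {v | ∃ k ∈ P.idxH xbar ∪ β₂, v = gradient (P.H k) x}

/-- MPSC piecewise constant rank of subspace component (MPSC-PCRSC) at `xbar`. -/
def PCRSC (P : MPSC n m p l) (xbar : EuclideanSpace ℝ (Fin n)) : Prop :=
  ∀ β₁ β₂ : Finset (Fin l), P.IsBipartition xbar β₁ β₂ →
    ∃ ε > 0, ∃ r : ℕ, ∀ x ∈ Metric.ball xbar ε,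
      Module.finrank ℝ (Submodule.span ℝ (P.branchGradients xbar β₁ β₂ x)) = r

/-- The residual
`(∑ [g_i⁺(x)]² + ∑ [h_j(x)]² + ∑ min {[G_k(x)]², [H_k(x)]²}) ^ (1/2)`. -/
noncomputable def residual (P : MPSC n m p l) (x : EuclideanSpace ℝ (Fin n)) : ℝ :=
  Real.sqrt ((∑ i, (max (P.g i x) 0) ^ 2) + (∑ j, (P.h j x) ^ 2)
    + ∑ k, min ((P.G k x) ^ 2) ((P.H k x) ^ 2))

/-- The local error bound at `xbar` with constant `α`. -/
def LocalErrorBoundWith (P : MPSC n m p l) (xbar : EuclideanSpace ℝ (Fin n)) (α : ℝ) : Prop :=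
  ∃ ε > 0, ∀ x ∈ Metric.ball xbar ε, Metric.infDist x P.feasible ≤ α * P.residual x

/-- The local error bound holds at `xbar`. -/
def LocalErrorBound (P : MPSC n m p l) (xbar : EuclideanSpace ℝ (Fin n)) : Prop :=
  ∃ α > 0, P.LocalErrorBoundWith xbar α

/-- `xbar` is a locally optimal solution of the program. -/
def IsLocallyOptimal (P : MPSC n m p l) (xbar : EuclideanSpace ℝ (Fin n)) : Prop :=
  xbar ∈ P.feasible ∧ IsLocalMinOn P.f P.feasible xbar

/-- The objective of the unconstrained penalty problem with parameter `κ`. -/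
noncomputable def penalty (P : MPSC n m p l) (κ : ℝ) (x : EuclideanSpace ℝ (Fin n)) : ℝ :=
  P.f x + κ * P.residual x

/-- The penalty problem admits a local exact penalization at `xbar`. -/
def LocalExactPenalization (P : MPSC n m p l) (xbar : EuclideanSpace ℝ (Fin n)) : Prop :=
  ∃ κbar > 0, ∀ κ > κbar, IsLocalMin (P.penalty κ) xbar

end MPSC

/-! Near a feasible point the program is a finite union of ordinary nonlinear programs, one for each
bipartition of the biactive set. At a given `x`, put `k` in `β₁` exactly when `|G k x| ≤ |H k x|`:
the residual then bounds every violation of that branch, so an error bound for each branch suffices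
(`PCRSC.branch_errorBound`, `PCRSC.localErrorBound`).

In one branch, the subspace component collects the inequalities that enter some nonnegative relation
between the active gradients with a positive coefficient. Adding such relations gives one with
coefficients at least 1 on the component and 0 off it (`exists_relation_of_positivelyDependent`). To
first order these inequalities are therefore equalities, a negative value forcing a violation
elsewhere (`eventually_sum_abs_le_of_relation`). Constant rank straightens the common zero set of
these equalities to a linear subspace (`exists_straightening_of_constantRank`). By Gordan's
alternative the other active inequalities have a common descent direction in that subspace
(`exists_direction_of_positivelyDependent`), and a step along it proportional to the violation
repairs them (`exists_near_solution_of_constantRank`).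

Exact penalization then follows by comparing `x` with a nearest feasible point
(`IsLocallyOptimal.isLocalMin_penalty`). -/

section ConstantRank

/-! ### Constant rank families and straightening of their zero set. -/

open Topology Filter InnerProductSpace

variable {E : Type*} [NormedAddCommGroup E] [InnerProductSpace ℝ E]

/-- The evaluation map `x ↦ (⟪v i, x⟫)ᵢ` of a linearly independent family has a right inverse. -/
theorem LinearIndependent.exists_inner_rightInverse [FiniteDimensional ℝ E] {ι : Type*} [Fintype ι]
    {v : ι → E} (hv : LinearIndependent ℝ v) :
    ∃ S : (ι → ℝ) →L[ℝ] E, ∀ c i, inner ℝ (v i) (S c) = c i := by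
  classical
  let T : E →ₗ[ℝ] (ι → ℝ) := LinearMap.pi fun i => (innerSL ℝ (v i)).toLinearMap
  have hT : T.range = ⊤ := by
    -- A nonzero functional vanishing on the range would have coordinates forming a nontrivial
    -- linear relation among the `v i`.
    by_contra hne
    obtain ⟨φ, hφ, hle⟩ := Submodule.exists_le_ker_of_lt_top T.range (lt_top_iff_ne_top.2 hne)
    have hsum : ∀ c, φ c = ∑ i, c i * φ (Pi.single i 1) := fun c => by
      conv_lhs => rw [pi_eq_sum_univ' c]
      simp
    have h0 : ∑ i, φ (Pi.single i 1) • v i = 0 := by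
      apply ext_inner_right ℝ
      intro x
      have := hle (LinearMap.mem_range_self T x)
      rw [LinearMap.mem_ker, hsum] at this
      rw [sum_inner, inner_zero_left, ← this]
      exact Finset.sum_congr rfl fun i _ => by simp [T, inner_smul_left, mul_comm]
    have := Fintype.linearIndependent_iff.1 hv _ h0
    apply hφ
    ext i
    simpa using this i
  obtain ⟨S, hS⟩ := T.exists_rightInverse_of_surjective hT
  refine ⟨LinearMap.toContinuousLinearMap S, fun c i => ?_⟩
  have := congrFun (LinearMap.congr_fun hS c) i
  simpa [T] using this

/-- A subfamily spanning the same space at `x₀` spans the same space near `x₀`, provided that the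
rank of the whole family is locally constant. -/
theorem eventually_span_range_comp_eq {X : Type*} [TopologicalSpace X] [FiniteDimensional ℝ E]
    {ι κ : Type*} [Finite κ] {v : ι → X → E} (hv : ∀ i, Continuous (v i)) {x₀ : X} {r : ℕ}
    (hr : ∀ᶠ x in 𝓝 x₀, Module.finrank ℝ (Submodule.span ℝ (Set.range fun i => v i x)) = r)
    {a : κ → ι} (ha : LinearIndependent ℝ fun k => v (a k) x₀)
    (hspan : Submodule.span ℝ (Set.range fun k => v (a k) x₀) =
      Submodule.span ℝ (Set.range fun i => v i x₀)) :
    ∀ᶠ x in 𝓝 x₀, Submodule.span ℝ (Set.range fun k => v (a k) x) =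
      Submodule.span ℝ (Set.range fun i => v i x) := by
  have := Fintype.ofFinite κ
  have hc : ContinuousAt (fun x k => v (a k) x) x₀ := by fun_prop
  have hcard : Fintype.card κ = r := by
    rw [← finrank_span_eq_card ha, hspan, hr.self_of_nhds]
  filter_upwards [hr, hc.eventually ha.eventually] with x hx hli
  refine Submodule.eq_of_le_of_finrank_eq (Submodule.span_mono ?_) ?_
  · rintro _ ⟨k, rfl⟩
    exact ⟨a k, rfl⟩
  · rw [finrank_span_eq_card hli, hx, hcard]

theorem continuous_gradient_of_contDiff [CompleteSpace E] {f : E → ℝ} (hf : ContDiff ℝ 1 f) :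
    Continuous (gradient f) :=
  (LinearIsometryEquiv.continuous _).comp (hf.continuous_fderiv one_ne_zero)

/-- Straightening of a family of constant rank: there is a local diffeomorphism `Ψ` at `0`, tangent
to the identity, mapping small vectors of the common kernel of the derivatives into the common zero
set, and every point near `x₀` is close to the image of such a vector. -/
theorem exists_straightening_of_constantRank [FiniteDimensional ℝ E] {ι : Type*} [Fintype ι]
    {F : ι → E → ℝ} (hF : ∀ i, ContDiff ℝ 1 (F i)) {x₀ : E} (h₀ : ∀ i, F i x₀ = 0) {r : ℕ}
    (hr : ∀ᶠ x in 𝓝 x₀,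
      Module.finrank ℝ (Submodule.span ℝ (Set.range fun i => gradient (F i) x)) = r) :
    ∃ Ψ Y : E → E, Ψ 0 = x₀ ∧ HasStrictFDerivAt Ψ (ContinuousLinearMap.id ℝ E) 0 ∧
      (∀ᶠ y in 𝓝 0, (∀ i, inner ℝ (gradient (F i) x₀) y = 0) → ∀ i, F i (Ψ y) = 0) ∧
      Tendsto Y (𝓝 x₀) (𝓝 0) ∧
      ∃ K : ℝ, 0 ≤ K ∧ ∀ᶠ x in 𝓝 x₀, (∀ i, inner ℝ (gradient (F i) x₀) (Y x) = 0) ∧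
        ‖x - Ψ (Y x)‖ ≤ K * ∑ i, |F i x| := by
  classical
  obtain ⟨κ, a, hinj, hspan, hli⟩ := exists_linearIndependent' ℝ fun i => gradient (F i) x₀
  have : Finite κ := Finite.of_injective a hinj
  have := Fintype.ofFinite κ
  have hsp := eventually_span_range_comp_eq
    (fun i => continuous_gradient_of_contDiff (hF i)) hr hli hspan
  obtain ⟨S, hS⟩ := hli.exists_inner_rightInverse
  simp only [Function.comp_apply] at hS
  let T : E →L[ℝ] (κ → ℝ) := ContinuousLinearMap.pi fun k => innerSL ℝ (gradient (F (a k)) x₀)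
  have hTS : ∀ c, T (S c) = c := fun c => funext fun k => hS c k
  let FB : E → κ → ℝ := fun x k => F (a k) x
  have hFB : ContDiff ℝ 1 FB := contDiff_pi.2 fun k => hF (a k)
  have hFB' : HasStrictFDerivAt FB T x₀ := by
    refine hasStrictFDerivAt_pi'.2 fun k => ?_
    convert! (hF (a k)).hasStrictFDerivAt (x := x₀) one_ne_zero using 1
    ext y
    simp [T, inner_gradient_left]
  have hFB0 : FB x₀ = 0 := funext fun k => h₀ (a k)
  -- The correction has zero derivative at `x₀`, so `Φ` is tangent to a translation. Since `T ∘ S =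
  -- id`, also `T ∘ Φ = FB`: in the new coordinates the basis functions are linear.
  let Φ : E → E := fun x => (x - x₀) + S (FB x - T (x - x₀))
  have hΦ : ContDiff ℝ 1 Φ := by fun_prop
  have hΦ0 : Φ x₀ = 0 := by simp [Φ, hFB0]
  have hTΦ : ∀ x, T (Φ x) = FB x := fun x => by simp only [Φ, map_add, hTS]; abel
  have hΦ' : HasStrictFDerivAt Φ (ContinuousLinearEquiv.refl ℝ E : E →L[ℝ] E) x₀ := by
    have h1 : HasStrictFDerivAt (fun x : E => x - x₀) (ContinuousLinearMap.id ℝ E) x₀ :=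
      (hasStrictFDerivAt_id x₀).sub_const x₀
    have h2 := h1.add (S.hasStrictFDerivAt.comp x₀
      (hFB'.sub (T.hasStrictFDerivAt.comp x₀ h1)))
    convert! h2 using 1
    ext y
    simp
  let Ψ := hΦ.contDiffAt.localInverse hΦ'.hasFDerivAt one_ne_zero
  have hright : ∀ᶠ y in 𝓝 (0 : E), Φ (Ψ y) = y := by
    rw [← hΦ0]; exact hΦ'.eventually_right_inverse
  have hleft : ∀ᶠ x in 𝓝 x₀, Ψ (Φ x) = x := hΦ'.eventually_left_inverse
  have hΨ0 : Ψ 0 = x₀ := by rw [← hΦ0]; exact hleft.self_of_nhds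
  have hΨs : HasStrictFDerivAt Ψ (ContinuousLinearMap.id ℝ E) 0 := by
    rw [← hΦ0]; exact hΦ'.to_localInverse
  have hΨc : ContDiffAt ℝ 1 Ψ 0 := by
    rw [← hΦ0]; exact hΦ.contDiffAt.to_localInverse hΦ'.hasFDerivAt one_ne_zero
  have hΨt : Tendsto Ψ (𝓝 0) (𝓝 x₀) := by
    have := hΨc.continuousAt.tendsto
    rwa [hΨ0] at this
  have hΨd : ∀ᶠ y in 𝓝 (0 : E), DifferentiableAt ℝ Ψ y := by
    filter_upwards [hΨc.eventually (by simp)] with y hy using hy.differentiableAt one_ne_zero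
  have hker : ∀ y, T y = 0 → ∀ i, inner ℝ (gradient (F i) x₀) y = 0 := fun y hy i => by
    have hle : Submodule.span ℝ (Set.range fun i => gradient (F i) x₀) ≤
        LinearMap.ker (innerSL ℝ y).toLinearMap := by
      rw [← hspan, Submodule.span_le]
      rintro _ ⟨k, rfl⟩
      have := congrFun hy k
      simpa [T, real_inner_comm] using this
    have := hle (Submodule.subset_span ⟨i, rfl⟩)
    simpa [real_inner_comm] using this
  -- Removing `S (T (Φ x))` projects `Φ x` onto `ker T`.
  let Y : E → E := fun x => Φ x - S (FB x)
  have hYt : Tendsto Y (𝓝 x₀) (𝓝 0) := by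
    have hY0 : Y x₀ = 0 := by simp [Y, hΦ0, hFB0]
    have hYc : Continuous Y := hΦ.continuous.sub (S.continuous.comp hFB.continuous)
    simpa only [hY0] using hYc.tendsto x₀
  refine ⟨Ψ, Y, hΨ0, hΨs, ?_, hYt, ?_⟩
  -- Along `t ↦ Ψ (t • y)` with `y ∈ ker T` the basis functions vanish, so their gradients
  -- annihilate the velocity. By constant rank these gradients span all the others, so every `F i`
  -- is constant along the curve.
  · have hev := (hright.eventually_nhds.and (hΨd.and (hΨt.eventually hsp)))
    obtain ⟨ρ, hρ, hball⟩ := Metric.eventually_nhds_iff_ball.1 hev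
    filter_upwards [Metric.ball_mem_nhds (0 : E) hρ] with y hy hyN i
    have hTy : T y = 0 := funext fun k => by simpa [T] using hyN (a k)
    have hmem : ∀ t ∈ Set.Icc (0 : ℝ) 1, t • y ∈ Metric.ball (0 : E) ρ := fun t ht => by
      rw [mem_ball_zero_iff] at hy ⊢
      rw [norm_smul, Real.norm_of_nonneg ht.1]
      exact (mul_le_of_le_one_left (norm_nonneg _) ht.2).trans_lt hy
    have hder : ∀ t ∈ Set.Icc (0 : ℝ) 1, ∀ i, HasDerivAt (fun t : ℝ => F i (Ψ (t • y)))
        (inner ℝ (gradient (F i) (Ψ (t • y))) (fderiv ℝ Ψ (t • y) y)) t := fun t ht i => by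
      have h1 : HasDerivAt (fun t : ℝ => t • y) y t := by
        simpa using (hasDerivAt_id t).smul_const y
      have h2 := (hball _ (hmem t ht)).2.1.hasFDerivAt.comp_hasDerivAt t h1
      have h3 := ((hF i).differentiable one_ne_zero _).hasFDerivAt.comp_hasDerivAt t h2
      rw [inner_gradient_left]
      exact h3
    have hzero : ∀ t ∈ Set.Icc (0 : ℝ) 1, ∀ i,
        inner ℝ (gradient (F i) (Ψ (t • y))) (fderiv ℝ Ψ (t • y) y) = 0 := fun t ht i => by
      have hle : Submodule.span ℝ (Set.range fun i => gradient (F i) (Ψ (t • y))) ≤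
          LinearMap.ker (innerSL ℝ (fderiv ℝ Ψ (t • y) y)).toLinearMap := by
        rw [← (hball _ (hmem t ht)).2.2, Submodule.span_le]
        rintro _ ⟨k, rfl⟩
        have h1 := hder t ht (a k)
        have h2 : (fun t : ℝ => F (a k) (Ψ (t • y))) =ᶠ[𝓝 t] fun _ => 0 := by
          have hc : Tendsto (fun t : ℝ => t • y) (𝓝 t) (𝓝 (t • y)) :=
            Continuous.tendsto (by fun_prop) t
          filter_upwards [hc.eventually (hball _ (hmem t ht)).1] with s hs
          have h3 := congrFun (hTΦ (Ψ (s • y))) k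
          rw [hs, map_smul, hTy] at h3
          simpa [FB] using h3.symm
        have h3 := h1.unique ((hasDerivAt_const t (0 : ℝ)).congr_of_eventuallyEq h2)
        simpa [real_inner_comm] using h3
      have := hle (Submodule.subset_span ⟨i, rfl⟩)
      simpa [real_inner_comm] using this
    have hconst := constant_of_has_deriv_right_zero (f := fun t : ℝ => F i (Ψ (t • y)))
      (a := 0) (b := 1) (fun t ht => (hder t ht i).continuousAt.continuousWithinAt)
      (fun t ht => by
        have ht' := Set.Ico_subset_Icc_self ht
        have := hder t ht' i
        rw [hzero t ht' i] at this
        exact this.hasDerivWithinAt) 1 (by simp)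
    simpa [hΨ0, h₀] using hconst
  · obtain ⟨L, s, hs, hL⟩ := hΨs.exists_lipschitzOnWith
    have hΦt : Tendsto Φ (𝓝 x₀) (𝓝 0) := by
      have := hΦ.continuous.tendsto x₀
      rwa [hΦ0] at this
    refine ⟨L * ‖S‖, by positivity, ?_⟩
    filter_upwards [hleft, hΦt.eventually hs, hYt.eventually hs] with x hx h1 h2
    refine ⟨hker _ (by simp only [Y, map_sub, hTΦ, hTS, sub_self]), ?_⟩
    have h3 := hL.norm_sub_le h1 h2
    rw [hx] at h3
    have h4 : Φ x - Y x = S (FB x) := by simp [Y]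
    rw [h4] at h3
    have hsum : 0 ≤ ∑ i, |F i x| := Finset.sum_nonneg fun i _ => abs_nonneg _
    have h5 : ‖FB x‖ ≤ ∑ i, |F i x| := by
      refine (pi_norm_le_iff_of_nonneg hsum).2 fun k => ?_
      exact Finset.single_le_sum (f := fun i => |F i x|) (fun i _ => abs_nonneg _)
        (Finset.mem_univ (a k))
    calc _ ≤ L * ‖S (FB x)‖ := h3
      _ ≤ L * (‖S‖ * ‖FB x‖) := by gcongr; exact S.le_opNorm _
      _ ≤ L * (‖S‖ * ∑ i, |F i x|) := by gcongr
      _ = _ := by ring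

end ConstantRank

/-! ### Theorems of the alternative and positively dependent gradients. -/

section Gordan

open Topology Filter InnerProductSpace

variable {E : Type*} [NormedAddCommGroup E] [InnerProductSpace ℝ E]

theorem exists_weights_of_mem_convexHull_range {β : Type*} [Fintype β] {u : β → E} {x : E}
    (hx : x ∈ convexHull ℝ (Set.range u)) :
    ∃ w : β → ℝ, (∀ b, 0 ≤ w b) ∧ ∑ b, w b = 1 ∧ ∑ b, w b • u b = x := by
  classical
  obtain ⟨ι, _, w, z, hw, hw1, hz, hsum⟩ := mem_convexHull_iff_exists_fintype.1 hx
  choose j hj using hz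
  refine ⟨fun b => ∑ i with j i = b, w i, fun b => Finset.sum_nonneg fun i _ => hw i, ?_, ?_⟩
  · rw [← hw1]
    exact Finset.sum_fiberwise _ _ _
  · rw [← hsum, ← Finset.sum_fiberwise (s := Finset.univ) (g := j)]
    refine Finset.sum_congr rfl fun b _ => ?_
    rw [Finset.sum_smul]
    refine Finset.sum_congr rfl fun i hi => ?_
    rw [← hj i, (Finset.mem_filter.1 hi).2]

/-- Gordan's alternative relative to a subspace `W`. -/
theorem exists_orthogonal_inner_le_neg_two [FiniteDimensional ℝ E] {β : Type*} [Fintype β]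
    (u : β → E) (W : Submodule ℝ E)
    (h : ∀ w : β → ℝ, (∀ b, 0 ≤ w b) → ∑ b, w b • u b ∈ W → ∀ b, w b = 0) :
    ∃ d ∈ Wᗮ, ∀ b, inner ℝ (u b) d ≤ -2 := by
  -- Modulo `W`, a convex combination equal to zero is a relation excluded by `h`; separating the
  -- hull from 0 then yields the direction.
  have h0 : (0 : E) ∉ convexHull ℝ (Set.range fun b => Wᗮ.starProjection (u b)) := fun h0 => by
    obtain ⟨w, hw, hw1, hsum⟩ := exists_weights_of_mem_convexHull_range h0
    have hW : ∑ b, w b • u b ∈ W := by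
      have : Wᗮ.starProjection (∑ b, w b • u b) = 0 := by simpa using hsum
      rw [Submodule.starProjection_apply_eq_zero_iff] at this
      simpa using this
    simp [h w hw hW] at hw1
  obtain ⟨f, c, hf, hc⟩ := geometric_hahn_banach_point_closed (convex_convexHull ℝ _)
    ((Set.finite_range fun b => Wᗮ.starProjection (u b)).isClosed_convexHull ℝ) h0
  rw [map_zero] at hf
  let y := (toDual ℝ E).symm f
  have hfy : ∀ b, c < inner ℝ (u b) (Wᗮ.starProjection y) := fun b => by
    have := hc _ (subset_convexHull ℝ _ ⟨b, rfl⟩)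
    rw [← Submodule.inner_starProjection_left_eq_right, real_inner_comm]
    simpa [y] using this
  refine ⟨-(2 / c) • Wᗮ.starProjection y,
    Submodule.smul_mem _ _ (Submodule.starProjection_apply_mem _ _), fun b => ?_⟩
  rw [inner_smul_right]
  have h2 : 2 / c * c ≤ 2 / c * inner ℝ (u b) (Wᗮ.starProjection y) := by
    gcongr
    exact (hfy b).le
  rw [div_mul_cancel₀ _ hf.ne'] at h2
  linarith

variable {ι κ : Type*} [Fintype κ] [DecidableEq ι]

/-- The indices `i ∈ A` for which `-v i` is a combination of the remaining `v j`, with nonnegative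
coefficients, and of the vectors `u k`, with arbitrary coefficients. -/
def positivelyDependent (A : Finset ι) (v : ι → E) (u : κ → E) : Set ι :=
  {i | i ∈ A ∧ ∃ (lam : ι → ℝ) (rho : κ → ℝ), (∀ j ∈ A, 0 ≤ lam j) ∧
    -v i = ∑ j ∈ A.erase i, lam j • v j + ∑ k, rho k • u k}

theorem mem_positivelyDependent_of_sum_eq_zero {A : Finset ι} {v : ι → E} {u : κ → E}
    {c : ι → ℝ} {e : κ → ℝ} (hc : ∀ j ∈ A, 0 ≤ c j)
    (h : ∑ j ∈ A, c j • v j + ∑ k, e k • u k = 0) {i : ι} (hi : i ∈ A) (hpos : 0 < c i) :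
    i ∈ positivelyDependent A v u := by
  refine ⟨hi, fun j => c j / c i, fun k => e k / c i, fun j hj => div_nonneg (hc j hj) hpos.le, ?_⟩
  rw [← Finset.add_sum_erase A _ hi] at h
  have h1 : ∑ j ∈ A.erase i, c j • v j + ∑ k, e k • u k = -(c i • v i) := by
    rw [eq_neg_iff_add_eq_zero, ← h]; abel
  have h2 : (c i)⁻¹ • (∑ j ∈ A.erase i, c j • v j + ∑ k, e k • u k) = -v i := by
    rw [h1, smul_neg, inv_smul_smul₀ hpos.ne']
  rw [← h2, smul_add, Finset.smul_sum, Finset.smul_sum]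
  simp only [smul_smul, div_eq_inv_mul]

/-- Each dependent index has its own relation, normalized to coefficient 1 there; the sum over all
of them works. An index with positive coefficient in the sum is itself dependent, which gives the
zeros elsewhere. -/
theorem exists_relation_of_positivelyDependent {A : Finset ι} {v : ι → E} {u : κ → E} :
    ∃ (c : ι → ℝ) (e : κ → ℝ), (∀ j ∈ A, 0 ≤ c j) ∧ (∀ j ∈ positivelyDependent A v u, 1 ≤ c j) ∧
      (∀ j ∈ A, j ∉ positivelyDependent A v u → c j = 0) ∧
      ∑ j ∈ A, c j • v j + ∑ k, e k • u k = 0 := by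
  classical
  have key : ∀ i, ∃ (c : ι → ℝ) (e : κ → ℝ), (∀ j ∈ A, 0 ≤ c j) ∧
      (i ∈ positivelyDependent A v u → 1 ≤ c i) ∧
      ∑ j ∈ A, c j • v j + ∑ k, e k • u k = 0 := fun i => by
    by_cases hi : i ∈ positivelyDependent A v u
    · obtain ⟨hiA, lam, rho, hlam, h⟩ := hi
      refine ⟨Function.update lam i 1, rho, fun j hj => ?_, fun _ => by simp, ?_⟩
      · by_cases hji : j = i
        · simp [hji]
        · simpa [hji] using hlam j hj
      · rw [← Finset.add_sum_erase A _ hiA]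
        have : ∑ j ∈ A.erase i, Function.update lam i 1 j • v j =
            ∑ j ∈ A.erase i, lam j • v j := Finset.sum_congr rfl fun j hj => by
          rw [Function.update_of_ne (Finset.ne_of_mem_erase hj)]
        rw [this, add_assoc, ← h]
        simp
    · exact ⟨0, 0, by simp, fun h => (hi h).elim, by simp⟩
  choose c e hc h1 h0 using key
  have hsum : ∑ j ∈ A, (∑ i ∈ A, c i j) • v j + ∑ k, (∑ i ∈ A, e i k) • u k = 0 := by
    simp only [Finset.sum_smul]
    rw [Finset.sum_comm, Finset.sum_comm (s := Finset.univ), ← Finset.sum_add_distrib]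
    exact Finset.sum_eq_zero fun i _ => h0 i
  have hnn : ∀ j ∈ A, 0 ≤ ∑ i ∈ A, c i j := fun j hj => Finset.sum_nonneg fun i _ => hc i j hj
  refine ⟨fun j => ∑ i ∈ A, c i j, fun k => ∑ i ∈ A, e i k, hnn, fun j hj => ?_,
    fun j hj hn => ?_, hsum⟩
  · exact (h1 j hj).trans (Finset.single_le_sum (f := fun i => c i j) (fun i _ => hc i j hj.1) hj.1)
  · by_contra hne
    exact hn (mem_positivelyDependent_of_sum_eq_zero hnn hsum hj
      (lt_of_le_of_ne (hnn j hj) (Ne.symm hne)))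

/-- Gordan's alternative for the independent indices `B`, relative to the span `W` of the dependent
`v j` and the `u k`. Its hypothesis holds because a nontrivial nonnegative combination from `B`
lying in `W` would make an index of `B` dependent. -/
theorem exists_direction_of_positivelyDependent [FiniteDimensional ℝ E]
    {A : Finset ι} {v : ι → E} {u : κ → E} :
    ∃ d : E, (∀ j ∈ positivelyDependent A v u, inner ℝ (v j) d = 0) ∧
      (∀ k, inner ℝ (u k) d = 0) ∧
      ∀ j ∈ A, j ∉ positivelyDependent A v u → inner ℝ (v j) d ≤ -2 := by
  classical
  obtain ⟨c, e, -, h1, hz, hrel⟩ :=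
    exists_relation_of_positivelyDependent (A := A) (v := v) (u := u)
  set J := positivelyDependent A v u
  let B := A.filter (· ∉ J)
  let D := A.filter (· ∈ J)
  let W := Submodule.span ℝ (Set.range (Sum.elim (fun j : D => v j) u))
  have hsplit : ∀ c : ι → ℝ, ∑ j ∈ A, c j • v j = ∑ j : D, c j • v j + ∑ j : B, c j • v j :=
    fun c => by
      rw [Finset.sum_coe_sort D fun j => c j • v j, Finset.sum_coe_sort B fun j => c j • v j]
      exact (Finset.sum_filter_add_sum_filter_not A _ _).symm
  obtain ⟨d, hd, hneg⟩ := exists_orthogonal_inner_le_neg_two (fun j : B => v j) W (by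
    intro w hw hW b
    obtain ⟨s, hs⟩ := (Submodule.mem_span_range_iff_exists_fun ℝ).1 hW
    rw [Fintype.sum_sum_type] at hs
    simp only [Sum.elim_inl, Sum.elim_inr] at hs
    by_contra hb
    obtain ⟨t, ht⟩ : ∃ t : ℝ, ∀ j : D, s (Sum.inl j) ≤ t :=
      (Set.finite_range fun j : D => s (Sum.inl j)).bddAbove.imp fun t ht j => ht ⟨j, rfl⟩
    let T := max t 0
    -- The coefficients `s` on `D` may have the wrong sign; adding `T` times the relation `c`, which
    -- is at least 1 on `D`, makes all coefficients nonnegative.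
    let c' : ι → ℝ := fun j => if hB : j ∈ B then w ⟨j, hB⟩ else
      if hD : j ∈ D then T * c j - s (Sum.inl ⟨j, hD⟩) else 0
    have hcB : ∀ j : B, c' j = w j := fun j => by simp [c', j.2]
    have hcD : ∀ j : D, c' j = T * c j - s (Sum.inl j) := fun j => by
      have : (j : ι) ∉ B := fun h => (Finset.mem_filter.1 h).2 (Finset.mem_filter.1 j.2).2
      simp [c', this]
    have hnn : ∀ j ∈ A, 0 ≤ c' j := fun j hj => by
      by_cases hjJ : j ∈ J
      · have hjD : j ∈ D := Finset.mem_filter.2 ⟨hj, hjJ⟩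
        rw [hcD ⟨j, hjD⟩]
        have h3 : T * 1 ≤ T * c j := mul_le_mul_of_nonneg_left (h1 j hjJ) (le_max_right _ _)
        have h4 := (ht ⟨j, hjD⟩).trans (le_max_left t 0)
        change _ ≤ T at h4
        dsimp only at h4 ⊢
        linarith
      · have hjB : j ∈ B := Finset.mem_filter.2 ⟨hj, hjJ⟩
        rw [hcB ⟨j, hjB⟩]
        exact hw _
    have hB0 : ∑ j : B, c j • v j = 0 := Finset.sum_eq_zero fun j _ => by
      rw [hz j (Finset.mem_filter.1 j.2).1 (Finset.mem_filter.1 j.2).2, zero_smul]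
    have hrel' : ∑ j ∈ A, c' j • v j + ∑ k, (T * e k - s (Sum.inr k)) • u k = 0 := by
      rw [hsplit, hB0, add_zero] at hrel
      rw [hsplit]
      simp only [hcB, hcD, sub_smul, Finset.sum_sub_distrib, mul_smul, ← Finset.smul_sum]
      rw [← hs]
      have : T • (∑ j : D, c j • v j + ∑ k, e k • u k) = 0 := by rw [hrel, smul_zero]
      rw [smul_add] at this
      rw [← this]
      abel
    have hbA := Finset.mem_filter.1 b.2
    refine hbA.2 (mem_positivelyDependent_of_sum_eq_zero hnn hrel' hbA.1 ?_)
    rw [hcB]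
    exact lt_of_le_of_ne (hw b) (Ne.symm hb))
  rw [Submodule.mem_orthogonal] at hd
  refine ⟨d, fun j hj => hd _
      (Submodule.subset_span ⟨Sum.inl ⟨j, Finset.mem_filter.2 ⟨hj.1, hj⟩⟩, rfl⟩),
    fun k => hd _ (Submodule.subset_span ⟨Sum.inr k, rfl⟩),
    fun j hj hjJ => hneg ⟨j, Finset.mem_filter.2 ⟨hj, hjJ⟩⟩⟩

end Gordan

/-! ### Error bounds for smooth systems under constant rank. -/

section ErrorBound

open Topology Filter InnerProductSpace

variable {E : Type*} [NormedAddCommGroup E] [InnerProductSpace ℝ E]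

theorem HasStrictFDerivAt.eventually_abs_sub_le {f : E → ℝ} {f' : E →L[ℝ] ℝ} {x₀ : E}
    (hf : HasStrictFDerivAt f f' x₀) {η : ℝ} (hη : 0 < η) :
    ∀ᶠ p : E × E in 𝓝 (x₀, x₀), |f p.1 - f p.2 - f' (p.1 - p.2)| ≤ η * ‖p.1 - p.2‖ :=
  hf.isLittleO.bound hη

/-- If a positive combination of the derivatives of the `a i`, modulo those of the `h k`, vanishes
at `x₀`, then near `x₀` the values `|a i x|` are controlled by the constraint violation. -/
theorem eventually_sum_abs_le_of_relation {α κ : Type*} [Fintype α] [Fintype κ]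
    {a : α → E → ℝ} {h : κ → E → ℝ} [CompleteSpace E]
    (ha : ∀ i, ContDiff ℝ 1 (a i)) (hh : ∀ k, ContDiff ℝ 1 (h k)) {x₀ : E}
    {c : α → ℝ} {e : κ → ℝ} (hc : ∀ i, 1 ≤ c i)
    (hrel : ∑ i, c i • gradient (a i) x₀ + ∑ k, e k • gradient (h k) x₀ = 0)
    {Z : E → E} (hZ : Tendsto Z (𝓝 x₀) (𝓝 x₀))
    (hZa : ∀ᶠ x in 𝓝 x₀, (∀ i, a i (Z x) = 0) ∧ ∀ k, h k (Z x) = 0) {K : ℝ} (hK : 0 ≤ K)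
    (hZK : ∀ᶠ x in 𝓝 x₀, ‖x - Z x‖ ≤ K * (∑ i, |a i x| + ∑ k, |h k x|)) :
    ∃ M : ℝ, 0 ≤ M ∧ ∀ᶠ x in 𝓝 x₀,
      ∑ i, |a i x| + ∑ k, |h k x| ≤ M * (∑ i, max (a i x) 0 + ∑ k, |h k x|) := by
  have hs : HasStrictFDerivAt (fun x => ∑ i, c i * a i x + ∑ k, e k * h k x)
      (0 : E →L[ℝ] ℝ) x₀ := by
    have h1 := (HasStrictFDerivAt.fun_sum (u := Finset.univ) fun i _ =>
      ((ha i).hasStrictFDerivAt (x := x₀) one_ne_zero).const_mul (c i)).add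
      (HasStrictFDerivAt.fun_sum (u := Finset.univ) fun k _ =>
      ((hh k).hasStrictFDerivAt (x := x₀) one_ne_zero).const_mul (e k))
    convert! h1 using 1
    ext y
    have := congrArg (fun v => inner ℝ v y) hrel
    simp only [inner_add_left, sum_inner, inner_smul_left, inner_gradient_left] at this
    simpa using this.symm
  let M := ∑ i, |c i| + ∑ k, |e k|
  have hM : 0 ≤ M := add_nonneg (Finset.sum_nonneg fun i _ => abs_nonneg _)
    (Finset.sum_nonneg fun i _ => abs_nonneg _)
  have hcM : ∀ i, c i ≤ M := fun i => (le_abs_self _).trans <|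
    (Finset.single_le_sum (f := fun i => |c i|) (fun i _ => abs_nonneg _) (Finset.mem_univ i)).trans
      (le_add_of_nonneg_right (Finset.sum_nonneg fun i _ => abs_nonneg _))
  have heM : ∀ k, |e k| ≤ M := fun k =>
    (Finset.single_le_sum (f := fun i => |e i|) (fun i _ => abs_nonneg _) (Finset.mem_univ k)).trans
      (le_add_of_nonneg_left (Finset.sum_nonneg fun i _ => abs_nonneg _))
  -- With this slope, `η * K ≤ 1 / 2`, so the first-order error is absorbed into half of the
  -- left-hand side.
  have hη : 0 < 1 / (2 * (K + 1)) := by positivity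
  have hp : Tendsto (fun x => (x, Z x)) (𝓝 x₀) (𝓝 (x₀, x₀)) := tendsto_id.prodMk_nhds hZ
  refine ⟨4 * M + 2, by linarith, ?_⟩
  filter_upwards [hp.eventually (hs.eventually_abs_sub_le hη), hZa, hZK] with x h1 h2 h3
  simp only [h2.1, h2.2, mul_zero, Finset.sum_const_zero, add_zero, sub_zero,
    zero_apply] at h1
  have hA : 0 ≤ ∑ i, |a i x| := Finset.sum_nonneg fun i _ => abs_nonneg _
  have hH : 0 ≤ ∑ k, |h k x| := Finset.sum_nonneg fun i _ => abs_nonneg _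
  have h4 : |∑ i, c i * a i x + ∑ k, e k * h k x| ≤ 1 / 2 * (∑ i, |a i x| + ∑ k, |h k x|) := by
    refine (h1.trans (mul_le_mul_of_nonneg_left h3 hη.le)).trans ?_
    rw [← mul_assoc]
    refine mul_le_mul_of_nonneg_right ?_ (by linarith)
    rw [div_mul_eq_mul_div, div_le_div_iff₀ (by positivity) (by norm_num)]
    linarith
  -- Termwise from `1 ≤ c i ≤ M`: where `a i x ≤ 0` the term `-c i * a i x` suffices, otherwise `2 *
  -- M - c i ≥ 1`.
  have h5 : ∑ i, |a i x| ≤ 2 * M * ∑ i, max (a i x) 0 - ∑ i, c i * a i x := by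
    rw [Finset.mul_sum, ← Finset.sum_sub_distrib]
    refine Finset.sum_le_sum fun i _ => ?_
    have hci := hc i
    have hcMi := hcM i
    rcases le_total (a i x) 0 with h | h
    · rw [max_eq_right h, abs_of_nonpos h]; nlinarith
    · rw [max_eq_left h, abs_of_nonneg h]; nlinarith
  have h6 : |∑ k, e k * h k x| ≤ M * ∑ k, |h k x| := by
    rw [Finset.mul_sum]
    refine (Finset.abs_sum_le_sum_abs _ _).trans (Finset.sum_le_sum fun k _ => ?_)
    rw [abs_mul]
    exact mul_le_mul_of_nonneg_right (heM k) (abs_nonneg _)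
  have h7 := abs_le.1 h4
  have h8 := abs_le.1 h6
  have h9 : 0 ≤ ∑ i, max (a i x) 0 := Finset.sum_nonneg fun i _ => le_max_right _ _
  nlinarith [mul_nonneg hM hH]

/-- Error bound for a system in which the family of the gradients of `a` and `h` has constant rank
near `x₀`, where the `a i` are tied by a positive relation and the remaining inequality constraints
`b j` admit a common descent direction in the kernel of these gradients. -/
theorem exists_near_solution_of_constantRank [FiniteDimensional ℝ E]
    {α β κ : Type*} [Fintype α] [Fintype β] [Fintype κ]
    {a : α → E → ℝ} {b : β → E → ℝ} {h : κ → E → ℝ}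
    (ha : ∀ i, ContDiff ℝ 1 (a i)) (hb : ∀ j, ContDiff ℝ 1 (b j)) (hh : ∀ k, ContDiff ℝ 1 (h k))
    {x₀ : E} (ha0 : ∀ i, a i x₀ = 0) (hb0 : ∀ j, b j x₀ ≤ 0) (hh0 : ∀ k, h k x₀ = 0)
    {c : α → ℝ} {e : κ → ℝ} (hc : ∀ i, 1 ≤ c i)
    (hrel : ∑ i, c i • gradient (a i) x₀ + ∑ k, e k • gradient (h k) x₀ = 0)
    {d : E} (hda : ∀ i, inner ℝ (gradient (a i) x₀) d = 0)
    (hdh : ∀ k, inner ℝ (gradient (h k) x₀) d = 0)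
    (hdb : ∀ j, inner ℝ (gradient (b j) x₀) d ≤ -2) {r : ℕ}
    (hr : ∀ᶠ x in 𝓝 x₀, Module.finrank ℝ (Submodule.span ℝ
      (Set.range fun i => gradient (Sum.elim a h i) x)) = r) :
    ∃ (w : E → E) (K : ℝ), Tendsto w (𝓝 x₀) (𝓝 x₀) ∧ 0 ≤ K ∧ ∀ᶠ x in 𝓝 x₀,
      (∀ i, a i (w x) = 0) ∧ (∀ j, b j (w x) ≤ 0) ∧ (∀ k, h k (w x) = 0) ∧
      ‖x - w x‖ ≤ K * (∑ i, max (a i x) 0 + ∑ j, max (b j x) 0 + ∑ k, |h k x|) := by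
  have hF : ∀ i, ContDiff ℝ 1 (Sum.elim a h i) := by rintro (i | k); exacts [ha i, hh k]
  have hF0 : ∀ i, Sum.elim a h i x₀ = 0 := by rintro (i | k); exacts [ha0 i, hh0 k]
  obtain ⟨Ψ, Y, hΨ0, hΨs, hΨN, hY, K, hK, hYK⟩ := exists_straightening_of_constantRank hF hF0 hr
  simp only [Sum.forall, Sum.elim_inl, Sum.elim_inr, Fintype.sum_sum_type] at hΨN hYK
  have hΨt : Tendsto Ψ (𝓝 0) (𝓝 x₀) := by
    have := hΨs.continuousAt.tendsto
    rwa [hΨ0] at this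
  have hZ : Tendsto (fun x => Ψ (Y x)) (𝓝 x₀) (𝓝 x₀) := hΨt.comp hY
  have hZ0 : ∀ᶠ x in 𝓝 x₀, (∀ i, a i (Ψ (Y x)) = 0) ∧ ∀ k, h k (Ψ (Y x)) = 0 := by
    filter_upwards [hY.eventually hΨN, hYK] with x h1 h2 using h1 h2.1
  obtain ⟨M, hM, hMx⟩ := eventually_sum_abs_le_of_relation ha hh hc hrel hZ hZ0 hK
    (hYK.mono fun x hx => hx.2)
  obtain ⟨LΨ, sΨ, hsΨ, hLΨ⟩ := hΨs.exists_lipschitzOnWith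
  choose Lb sb hsb hLb using fun j =>
    ((hb j).hasStrictFDerivAt (x := x₀) one_ne_zero).exists_lipschitzOnWith
  let Lm : ℝ := ∑ j, (Lb j : ℝ)
  have hLm : 0 ≤ Lm := Finset.sum_nonneg fun j _ => (Lb j).2
  have hLbm : ∀ j, (Lb j : ℝ) ≤ Lm := fun j =>
    Finset.single_le_sum (f := fun j => (Lb j : ℝ)) (fun j _ => (Lb j).2) (Finset.mem_univ j)
  let R : E → ℝ := fun x => ∑ i, max (a i x) 0 + ∑ j, max (b j x) 0 + ∑ k, |h k x|
  -- Step length along `d`: it dominates the initial violation `R x` plus the growth of `b j` in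
  -- moving from `x` to `Ψ (Y x)`.
  let t : E → ℝ := fun x => (1 + Lm * (K * M)) * R x
  have hRc : Continuous R := by
    have h1 := fun i => (ha i).continuous
    have h2 := fun i => (hb i).continuous
    have h3 := fun i => (hh i).continuous
    refine ((continuous_finsetSum _ fun i _ => (h1 i).max continuous_const).add
      (continuous_finsetSum _ fun i _ => (h2 i).max continuous_const)).add
      (continuous_finsetSum _ fun i _ => (h3 i).abs)
  have ht : Tendsto t (𝓝 x₀) (𝓝 0) := by
    have ht0 : t x₀ = 0 := by simp [t, R, ha0, hh0, hb0]
    have htc : Continuous t := continuous_const.mul hRc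
    simpa only [ht0] using htc.tendsto x₀
  have hYt : Tendsto (fun x => Y x + t x • d) (𝓝 x₀) (𝓝 0) := by
    simpa using hY.add (ht.smul_const d)
  -- `Ψ` is tangent to the identity, so `b j ∘ Ψ` has the derivative of `b j`. The step `t x • d`
  -- then costs an error of at most `t x`; slope `-2` pays for it and for `b j (Ψ (Y x)) ≤ t x`.
  have hdesc : ∀ j, ∀ᶠ p : E × E in 𝓝 (0, 0),
      |b j (Ψ p.1) - b j (Ψ p.2) - inner ℝ (gradient (b j) x₀) (p.1 - p.2)| ≤
        1 / (1 + ‖d‖) * ‖p.1 - p.2‖ := fun j => by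
    have h1 : HasStrictFDerivAt (b j) (fderiv ℝ (b j) x₀) (Ψ 0) := by
      rw [hΨ0]; exact (hb j).hasStrictFDerivAt one_ne_zero
    have h2 := (h1.comp 0 hΨs).eventually_abs_sub_le (η := 1 / (1 + ‖d‖)) (by positivity)
    simpa [inner_gradient_left] using h2
  refine ⟨fun x => Ψ (Y x + t x • d), K * M + LΨ * ((1 + Lm * (K * M)) * ‖d‖),
    hΨt.comp hYt, by positivity, ?_⟩
  have hdN : ∀ y : E, ((∀ i, inner ℝ (gradient (a i) x₀) y = 0) ∧
      ∀ k, inner ℝ (gradient (h k) x₀) y = 0) → ∀ s : ℝ,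
      (∀ i, inner ℝ (gradient (a i) x₀) (y + s • d) = 0) ∧
      ∀ k, inner ℝ (gradient (h k) x₀) (y + s • d) = 0 := fun y hy s =>
    ⟨fun i => by simp [inner_add_right, inner_smul_right, hy.1, hda],
      fun k => by simp [inner_add_right, inner_smul_right, hy.2, hdh]⟩
  filter_upwards [hYK, hMx, hYt.eventually hΨN, hY.eventually hsΨ, hYt.eventually hsΨ,
    eventually_all.2 fun j => hsb j, hZ.eventually (eventually_all.2 fun j => hsb j),
    (hYt.prodMk_nhds hY).eventually (eventually_all.2 hdesc)]
    with x h1 h2 h3 h4 h5 h6 h7 h8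
  obtain ⟨hwa, hwh⟩ := h3 (hdN _ h1.1 _)
  have hA : 0 ≤ ∑ i, max (a i x) 0 := Finset.sum_nonneg fun i _ => le_max_right _ _
  have hB : 0 ≤ ∑ j, max (b j x) 0 := Finset.sum_nonneg fun i _ => le_max_right _ _
  have hH : 0 ≤ ∑ k, |h k x| := Finset.sum_nonneg fun i _ => abs_nonneg _
  have hR : 0 ≤ R x := by positivity
  have ht0 : 0 ≤ t x := by positivity
  have hxz : ‖x - Ψ (Y x)‖ ≤ K * M * R x := by
    refine h1.2.trans ?_
    rw [mul_assoc]
    refine mul_le_mul_of_nonneg_left (h2.trans (mul_le_mul_of_nonneg_left ?_ hM)) hK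
    change _ ≤ _ + _ + _
    linarith
  refine ⟨hwa, fun j => ?_, hwh, ?_⟩
  · have e1 := abs_le.1 (h8 j)
    simp only [add_sub_cancel_left, inner_smul_right, norm_smul, Real.norm_of_nonneg ht0] at e1
    have e2 : 1 / (1 + ‖d‖) * (t x * ‖d‖) ≤ t x := by
      rw [div_mul_eq_mul_div, div_le_iff₀ (by positivity)]
      nlinarith [norm_nonneg d]
    have e3 : t x * inner ℝ (gradient (b j) x₀) d ≤ t x * (-2) :=
      mul_le_mul_of_nonneg_left (hdb j) ht0
    have e4 := (hLb j).norm_sub_le (h7 j) (h6 j)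
    have e5 : ‖b j (Ψ (Y x)) - b j x‖ ≤ Lm * (K * M * R x) := by
      refine e4.trans (mul_le_mul (hLbm j) ?_ (norm_nonneg _) hLm)
      rw [norm_sub_rev]; exact hxz
    have e6 := (abs_le.1 e5).2
    have e7 : b j x ≤ R x := by
      have : b j x ≤ ∑ j, max (b j x) 0 := (le_max_left _ 0).trans
        (Finset.single_le_sum (f := fun j => max (b j x) 0) (fun i _ => le_max_right _ _)
          (Finset.mem_univ j))
      change _ ≤ _ + _ + _
      linarith
    have e8 : t x = R x + Lm * (K * M * R x) := by simp only [t]; ring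
    linarith [e1.2]
  · have e1 := hLΨ.norm_sub_le h4 h5
    simp only [sub_add_cancel_left, norm_neg, norm_smul, Real.norm_of_nonneg ht0] at e1
    calc ‖x - Ψ (Y x + t x • d)‖
        ≤ ‖x - Ψ (Y x)‖ + ‖Ψ (Y x) - Ψ (Y x + t x • d)‖ := norm_sub_le_norm_sub_add_norm_sub _ _ _
      _ ≤ K * M * R x + LΨ * (t x * ‖d‖) := add_le_add hxz e1
      _ = _ := by simp only [t, R]; ring

end ErrorBound

/-! ### Branch problems of the switching program. -/

namespace MPSC

open Topology Filter InnerProductSpace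

variable {n m p l : ℕ} (P : MPSC n m p l) {xbar : EuclideanSpace ℝ (Fin n)}

/-- The equality constraints of the branch problem in which `G k = 0` for `k ∈ S` and `H k = 0` for
`k ∈ T`. -/
def branchEq (S T : Finset (Fin l)) :
    Fin p ⊕ (S ⊕ T) → EuclideanSpace ℝ (Fin n) → ℝ :=
  Sum.elim P.h (Sum.elim (fun k => P.G k) fun k => P.H k)

theorem sum_branchEq_smul_gradient (S T : Finset (Fin l)) (x : EuclideanSpace ℝ (Fin n))
    (rho : Fin p ⊕ (S ⊕ T) → ℝ) :
    ∑ k, rho k • gradient (P.branchEq S T k) x = (∑ j, rho (Sum.inl j) • gradient (P.h j) x)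
      + ((∑ k : S, rho (Sum.inr (Sum.inl k)) • gradient (P.G k) x)
      + ∑ k : T, rho (Sum.inr (Sum.inr k)) • gradient (P.H k) x) := by
  simp only [Fintype.sum_sum_type, branchEq, Sum.elim_inl, Sum.elim_inr]

theorem subspaceComponent_eq_positivelyDependent (β₁ β₂ : Finset (Fin l)) :
    P.subspaceComponent xbar β₁ β₂ = positivelyDependent (P.activeIneq xbar)
      (fun i => gradient (P.g i) xbar)
      (fun k => gradient (P.branchEq (P.idxG xbar ∪ β₁) (P.idxH xbar ∪ β₂) k) xbar) := by
  ext i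
  refine and_congr_right fun _ => ⟨?_, ?_⟩
  · rintro ⟨lam, rho, mu, nu, hlam, h⟩
    refine ⟨lam, Sum.elim rho (Sum.elim (fun k => mu k) fun k => nu k), hlam, ?_⟩
    rw [sum_branchEq_smul_gradient, h]
    simp only [Sum.elim_inl, Sum.elim_inr]
    rw [Finset.sum_coe_sort _ fun k => mu k • gradient (P.G k) xbar,
      Finset.sum_coe_sort _ fun k => nu k • gradient (P.H k) xbar]
    abel
  · rintro ⟨lam, rho, hlam, h⟩
    refine ⟨lam, fun j => rho (Sum.inl j),
      -- Multipliers outside the index set never enter the sum, so the default is immaterial.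
      fun k => if hk : k ∈ P.idxG xbar ∪ β₁ then rho (Sum.inr (Sum.inl ⟨k, hk⟩)) else 0,
      fun k => if hk : k ∈ P.idxH xbar ∪ β₂ then rho (Sum.inr (Sum.inr ⟨k, hk⟩)) else 0, hlam, ?_⟩
    rw [sum_branchEq_smul_gradient] at h
    rw [h, ← Finset.sum_coe_sort (P.idxG xbar ∪ β₁), ← Finset.sum_coe_sort (P.idxH xbar ∪ β₂)]
    simp only [Finset.coe_mem, dif_pos, Subtype.coe_eta]
    abel

theorem branchGradients_eq_range (β₁ β₂ : Finset (Fin l)) (x : EuclideanSpace ℝ (Fin n)) :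
    P.branchGradients xbar β₁ β₂ x = Set.range fun i =>
      gradient (Sum.elim (fun i : P.subspaceComponent xbar β₁ β₂ => P.g i)
        (P.branchEq (P.idxG xbar ∪ β₁) (P.idxH xbar ∪ β₂)) i) x := by
  ext v
  simp only [branchGradients, branchEq, Set.mem_union, Set.mem_ofPred_eq, Set.mem_range, Sum.exists,
    Sum.elim_inl, Sum.elim_inr, Subtype.exists, exists_prop, or_assoc, @eq_comm _ v]

theorem contDiff_one_g (i : Fin m) : ContDiff ℝ 1 (P.g i) :=
  (P.contDiff_g i).of_le (by norm_num)

theorem contDiff_one_branchEq (S T : Finset (Fin l)) (k : Fin p ⊕ (S ⊕ T)) :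
    ContDiff ℝ 1 (P.branchEq S T k) := by
  rcases k with j | k | k
  · exact (P.contDiff_h j).of_le (by norm_num)
  · exact (P.contDiff_G k).of_le (by norm_num)
  · exact (P.contDiff_H k).of_le (by norm_num)

variable {P}

theorem mem_idx_of_mem_feasible (hx : xbar ∈ P.feasible) {β₁ β₂ : Finset (Fin l)}
    (hβ : β₁ ∪ β₂ = P.idxGH xbar) (k : Fin l) :
    k ∈ P.idxG xbar ∪ β₁ ∨ k ∈ P.idxH xbar ∪ β₂ := by
  have h := mul_eq_zero.1 (hx.2.2 k)
  by_cases hG : P.G k xbar = 0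
  · by_cases hH : P.H k xbar = 0
    · have : k ∈ β₁ ∪ β₂ := by rw [hβ]; simp [idxGH, hG, hH]
      rcases Finset.mem_union.1 this with h | h <;> simp [h]
    · simp [idxG, hG, hH]
  · have hH := h.resolve_left hG
    simp [idxH, hG, hH]

theorem branchEq_eq_zero {β₁ β₂ : Finset (Fin l)} (hx : xbar ∈ P.feasible)
    (hβ : β₁ ∪ β₂ = P.idxGH xbar) (k) :
    P.branchEq (P.idxG xbar ∪ β₁) (P.idxH xbar ∪ β₂) k xbar = 0 := by
  have h1 : ∀ k ∈ β₁ ∪ β₂, P.G k xbar = 0 ∧ P.H k xbar = 0 := fun k hk => by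
    rw [hβ] at hk
    simpa [idxGH] using hk
  rcases k with j | k | k
  · exact hx.2.1 j
  · rcases Finset.mem_union.1 k.2 with h | h
    · exact (Finset.mem_filter.1 h).2.1
    · exact (h1 _ (Finset.mem_union_left _ h)).1
  · rcases Finset.mem_union.1 k.2 with h | h
    · exact (Finset.mem_filter.1 h).2.2
    · exact (h1 _ (Finset.mem_union_right _ h)).2

theorem sum_le_card_mul {γ : Type*} [Fintype γ] {f : γ → ℝ} {ρ : ℝ} (h : ∀ i, f i ≤ ρ) :
    ∑ i, f i ≤ Fintype.card γ * ρ := by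
  simpa using Finset.sum_le_card_nsmul Finset.univ f ρ fun i _ => h i

/-- Error bound for a single branch problem, in terms of a common bound `ρ` of the violations. -/
theorem PCRSC.branch_errorBound (hP : P.PCRSC xbar) (hx : xbar ∈ P.feasible)
    {β₁ β₂ : Finset (Fin l)} (hβ : P.IsBipartition xbar β₁ β₂) :
    ∃ K : ℝ, 0 ≤ K ∧ ∀ᶠ x in 𝓝 xbar, ∀ ρ : ℝ, (∀ i, max (P.g i x) 0 ≤ ρ) →
      (∀ k, |P.branchEq (P.idxG xbar ∪ β₁) (P.idxH xbar ∪ β₂) k x| ≤ ρ) →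
      Metric.infDist x P.feasible ≤ K * ρ := by
  classical
  obtain ⟨ε, hε, r, hr⟩ := hP β₁ β₂ hβ
  let J := P.subspaceComponent xbar β₁ β₂
  have hJ : J = _ := P.subspaceComponent_eq_positivelyDependent β₁ β₂
  have hJA : ∀ i ∈ J, i ∈ P.activeIneq xbar := fun i hi => hi.1
  have hact : ∀ i, i ∈ P.activeIneq xbar ↔ P.g i xbar = 0 := fun i => by simp [activeIneq]
  obtain ⟨c, e, -, hc1, hc0, hrel⟩ := exists_relation_of_positivelyDependent
    (A := P.activeIneq xbar) (v := fun i => gradient (P.g i) xbar)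
    (u := fun k => gradient (P.branchEq (P.idxG xbar ∪ β₁) (P.idxH xbar ∪ β₂) k) xbar)
  obtain ⟨d, hdJ, hdh, hdb⟩ := exists_direction_of_positivelyDependent
    (A := P.activeIneq xbar) (v := fun i => gradient (P.g i) xbar)
    (u := fun k => gradient (P.branchEq (P.idxG xbar ∪ β₁) (P.idxH xbar ∪ β₂) k) xbar)
  rw [← hJ] at hc1 hc0 hdJ hdb
  have hrel' : ∑ i : J, c i • gradient (P.g i) xbar + ∑ k, e k •
      gradient (P.branchEq (P.idxG xbar ∪ β₁) (P.idxH xbar ∪ β₂) k) xbar = 0 := by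
    rw [← hrel]
    congr 1
    rw [← Finset.sum_filter_add_sum_filter_not (P.activeIneq xbar) (· ∈ J),
      Finset.sum_eq_zero (s := (P.activeIneq xbar).filter (· ∉ J)), add_zero]
    · refine (Finset.sum_subtype _ (fun i => ?_) fun i => c i • gradient (P.g i) xbar).symm
      simpa using hJA i
    · intro i hi
      rw [hc0 i (Finset.mem_filter.1 hi).1 (Finset.mem_filter.1 hi).2, zero_smul]
  obtain ⟨w, K, hw, hK, hwK⟩ := exists_near_solution_of_constantRank
    (a := fun i : J => P.g i) (b := fun j : {j // j ∈ P.activeIneq xbar ∧ j ∉ J} => P.g j)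
    (h := P.branchEq (P.idxG xbar ∪ β₁) (P.idxH xbar ∪ β₂)) (c := fun i : J => c i) (e := e)
    (fun i => P.contDiff_one_g i) (fun j => P.contDiff_one_g j) (P.contDiff_one_branchEq _ _)
    (fun i => (hact i).1 (hJA i i.2)) (fun j => hx.1 j) (branchEq_eq_zero hx hβ.2)
    (fun i => hc1 i i.2) hrel' (fun i => hdJ i i.2) hdh (fun j => hdb j j.2.1 j.2.2) (r := r)
    (by
      filter_upwards [Metric.ball_mem_nhds xbar hε] with x hxε
      rw [← hr x hxε, branchGradients_eq_range])
  -- Inactive constraints are not in the system solved by `w`; they survive by continuity since `w x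
  -- → xbar`.
  have hinact : ∀ᶠ x in 𝓝 xbar, ∀ i, i ∉ P.activeIneq xbar → P.g i (w x) ≤ 0 := by
    refine eventually_all.2 fun i => ?_
    by_cases hi : i ∈ P.activeIneq xbar
    · simp [hi]
    · have hlt : P.g i xbar < 0 := lt_of_le_of_ne (hx.1 i) fun h => hi ((hact i).2 h)
      have hlim : Tendsto (fun x => P.g i (w x)) (𝓝 xbar) (𝓝 (P.g i xbar)) :=
        ((P.contDiff_one_g i).continuous.tendsto xbar).comp hw
      filter_upwards [hlim.eventually_lt_const hlt] with x h _ using h.le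
  refine ⟨K * (Fintype.card J + Fintype.card {j // j ∈ P.activeIneq xbar ∧ j ∉ J} +
    Fintype.card (Fin p ⊕ (↥(P.idxG xbar ∪ β₁) ⊕ ↥(P.idxH xbar ∪ β₂)))), by positivity, ?_⟩
  filter_upwards [hwK, hinact] with x h1 h2 ρ hg he
  obtain ⟨hwa, hwb, hwh, hwx⟩ := h1
  have hmem : w x ∈ P.feasible := by
    refine ⟨fun i => ?_, fun j => hwh (Sum.inl j), fun k => ?_⟩
    · by_cases hi : i ∈ P.activeIneq xbar
      · by_cases hiJ : i ∈ J
        · exact (hwa ⟨i, hiJ⟩).le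
        · exact hwb ⟨i, hi, hiJ⟩
      · exact h2 i hi
    · rcases mem_idx_of_mem_feasible hx hβ.2 k with hk | hk
      · exact mul_eq_zero_of_left (hwh (Sum.inr (Sum.inl ⟨k, hk⟩))) _
      · exact mul_eq_zero_of_right _ (hwh (Sum.inr (Sum.inr ⟨k, hk⟩)))
  refine (Metric.infDist_le_dist_of_mem hmem).trans ?_
  rw [dist_eq_norm]
  refine hwx.trans ?_
  rw [mul_assoc, add_mul, add_mul]
  refine mul_le_mul_of_nonneg_left (add_le_add (add_le_add ?_ ?_) ?_) hK
  · exact sum_le_card_mul fun i => hg _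
  · exact sum_le_card_mul fun i => hg _
  · exact sum_le_card_mul fun i => he _

/-! ### The residual dominates the individual violations. -/

section Residual

variable (P) (x : EuclideanSpace ℝ (Fin n))

theorem residual_nonneg : 0 ≤ P.residual x := Real.sqrt_nonneg _

theorem abs_le_residual {a : ℝ} (h : a ^ 2 ≤ ∑ i, (max (P.g i x) 0) ^ 2 ∨
    a ^ 2 ≤ ∑ j, (P.h j x) ^ 2 ∨ a ^ 2 ≤ ∑ k, min ((P.G k x) ^ 2) ((P.H k x) ^ 2)) :
    |a| ≤ P.residual x := by
  refine Real.abs_le_sqrt ?_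
  have h1 : 0 ≤ ∑ i, (max (P.g i x) 0) ^ 2 := Finset.sum_nonneg fun i _ => sq_nonneg _
  have h2 : 0 ≤ ∑ j, (P.h j x) ^ 2 := Finset.sum_nonneg fun i _ => sq_nonneg _
  have h3 : 0 ≤ ∑ k, min ((P.G k x) ^ 2) ((P.H k x) ^ 2) :=
    Finset.sum_nonneg fun i _ => le_min (sq_nonneg _) (sq_nonneg _)
  rcases h with h | h | h <;> linarith

theorem max_g_le_residual (i : Fin m) : max (P.g i x) 0 ≤ P.residual x :=
  (le_abs_self _).trans <| P.abs_le_residual x <| Or.inl <|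
    Finset.single_le_sum (f := fun i => (max (P.g i x) 0) ^ 2) (fun _ _ => sq_nonneg _)
      (Finset.mem_univ i)

theorem abs_h_le_residual (j : Fin p) : |P.h j x| ≤ P.residual x :=
  P.abs_le_residual x <| Or.inr <| Or.inl <|
    Finset.single_le_sum (f := fun j => (P.h j x) ^ 2) (fun _ _ => sq_nonneg _) (Finset.mem_univ j)

theorem min_sq_le_sum (k : Fin l) :
    min ((P.G k x) ^ 2) ((P.H k x) ^ 2) ≤ ∑ k, min ((P.G k x) ^ 2) ((P.H k x) ^ 2) :=
  Finset.single_le_sum (f := fun k => min ((P.G k x) ^ 2) ((P.H k x) ^ 2))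
    (fun _ _ => le_min (sq_nonneg _) (sq_nonneg _)) (Finset.mem_univ k)

variable {P x}

theorem abs_G_le_residual {k : Fin l} (hk : |P.G k x| ≤ |P.H k x|) :
    |P.G k x| ≤ P.residual x :=
  P.abs_le_residual x <| Or.inr <| Or.inr <|
    (min_eq_left (sq_le_sq.2 hk)).symm.trans_le (P.min_sq_le_sum x k)

theorem abs_H_le_residual {k : Fin l} (hk : |P.H k x| ≤ |P.G k x|) :
    |P.H k x| ≤ P.residual x :=
  P.abs_le_residual x <| Or.inr <| Or.inr <|
    (min_eq_right (sq_le_sq.2 hk)).symm.trans_le (P.min_sq_le_sum x k)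

theorem residual_eq_zero (hx : x ∈ P.feasible) : P.residual x = 0 := by
  have h : ∀ k, min ((P.G k x) ^ 2) ((P.H k x) ^ 2) = 0 := fun k => by
    rcases mul_eq_zero.1 (hx.2.2 k) with h | h <;> simp [h, sq_nonneg]
  simp [residual, h, hx.1, hx.2.1]

end Residual

theorem eventually_abs_le_abs {X : Type*} [TopologicalSpace X] {a b : X → ℝ} {x₀ : X}
    (ha : ContinuousAt a x₀) (hb : ContinuousAt b x₀) (ha0 : a x₀ = 0) (hb0 : b x₀ ≠ 0) :
    ∀ᶠ x in 𝓝 x₀, |a x| ≤ |b x| := by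
  have h : |a x₀| < |b x₀| := by rw [ha0, abs_zero]; exact abs_pos.2 hb0
  exact (ha.abs.eventually_lt hb.abs h).mono fun x hx => hx.le

/-- The branch may vary with `x`: there are finitely many, so one neighbourhood and the sum of the
branch constants serve all. On `I_G` and `I_H` the vanishing factor is the smaller one near `xbar`.
-/
theorem PCRSC.localErrorBound (hP : P.PCRSC xbar) (hx : xbar ∈ P.feasible) :
    P.LocalErrorBound xbar := by
  classical
  -- Quantifying over all pairs, with constant 0 for those that are not bipartitions, permits a
  -- plain finite sum.
  have key : ∀ β : Finset (Fin l) × Finset (Fin l), ∃ K : ℝ, 0 ≤ K ∧ ∀ᶠ x in 𝓝 xbar,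
      P.IsBipartition xbar β.1 β.2 → ∀ ρ : ℝ, (∀ i, max (P.g i x) 0 ≤ ρ) →
      (∀ k, |P.branchEq (P.idxG xbar ∪ β.1) (P.idxH xbar ∪ β.2) k x| ≤ ρ) →
      Metric.infDist x P.feasible ≤ K * ρ := fun β => by
    by_cases hβ : P.IsBipartition xbar β.1 β.2
    · obtain ⟨K, hK, h⟩ := hP.branch_errorBound hx hβ
      exact ⟨K, hK, h.mono fun x hx _ => hx⟩
    · exact ⟨0, le_rfl, Eventually.of_forall fun x h => (hβ h).elim⟩
  choose K hK hKx using key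
  have hKs : 0 ≤ ∑ β, K β := Finset.sum_nonneg fun β _ => hK β
  have hG : ∀ᶠ x in 𝓝 xbar, ∀ k, k ∈ P.idxG xbar → |P.G k x| ≤ |P.H k x| := by
    refine eventually_all.2 fun k => ?_
    by_cases hk : k ∈ P.idxG xbar
    · have h := (Finset.mem_filter.1 hk).2
      filter_upwards [eventually_abs_le_abs (P.contDiff_G k).continuous.continuousAt
        (P.contDiff_H k).continuous.continuousAt h.1 h.2] with x hx _ using hx
    · simp [hk]
  have hH : ∀ᶠ x in 𝓝 xbar, ∀ k, k ∈ P.idxH xbar → |P.H k x| ≤ |P.G k x| := by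
    refine eventually_all.2 fun k => ?_
    by_cases hk : k ∈ P.idxH xbar
    · have h := (Finset.mem_filter.1 hk).2
      filter_upwards [eventually_abs_le_abs (P.contDiff_H k).continuous.continuousAt
        (P.contDiff_G k).continuous.continuousAt h.2 h.1] with x hx _ using hx
    · simp [hk]
  obtain ⟨ε, hε, hball⟩ := Metric.eventually_nhds_iff_ball.1
    (hG.and (hH.and (eventually_all.2 hKx)))
  refine ⟨∑ β, K β + 1, by linarith, ε, hε, fun x hxε => ?_⟩
  obtain ⟨hGx, hHx, hx'⟩ := hball x hxε
  let β₁ := (P.idxGH xbar).filter fun k => |P.G k x| ≤ |P.H k x|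
  let β₂ := (P.idxGH xbar).filter fun k => ¬|P.G k x| ≤ |P.H k x|
  have hβ : P.IsBipartition xbar β₁ β₂ :=
    ⟨Finset.disjoint_filter_filter_not _ _ _, Finset.filter_union_filter_not_eq _ _⟩
  have h1 := hx' (β₁, β₂) hβ (P.residual x) (P.max_g_le_residual x) (by
    rintro (j | k | k)
    · exact P.abs_h_le_residual x j
    · refine abs_G_le_residual ?_
      rcases Finset.mem_union.1 k.2 with h | h
      · exact hGx _ h
      · exact (Finset.mem_filter.1 h).2
    · refine abs_H_le_residual ?_
      rcases Finset.mem_union.1 k.2 with h | h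
      · exact hHx _ h
      · exact (not_le.1 (Finset.mem_filter.1 h).2).le)
  refine h1.trans (mul_le_mul_of_nonneg_right ?_ (P.residual_nonneg x))
  have := Finset.single_le_sum (f := K) (fun β _ => hK β) (Finset.mem_univ (β₁, β₂))
  linarith

/-! ### Exact penalization. -/

theorem isClosed_feasible : IsClosed P.feasible := by
  have hg := fun i => (P.contDiff_g i).continuous
  have hh := fun i => (P.contDiff_h i).continuous
  have hG := fun i => (P.contDiff_G i).continuous
  have hH := fun i => (P.contDiff_H i).continuous
  simp only [feasible, Set.ofPred_and, Set.ofPred_forall]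
  exact (isClosed_iInter fun i => isClosed_le (hg i) continuous_const).inter
    ((isClosed_iInter fun j => isClosed_eq (hh j) continuous_const).inter
      (isClosed_iInter fun k => isClosed_eq ((hG k).mul (hH k)) continuous_const))

/-- For a nearest feasible point `z` to `x`, `f xbar ≤ f z ≤ f x + L * dist x z ≤ f x + κ * r x`,
while the residual vanishes at `xbar`. -/
theorem IsLocallyOptimal.isLocalMin_penalty (hopt : P.IsLocallyOptimal xbar) {α : ℝ}
    (hEB : P.LocalErrorBoundWith xbar α) {L : ℝ≥0} {δ : ℝ} (hδ : 0 < δ)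
    (hL : LipschitzOnWith L P.f (Metric.ball xbar δ)) {κ : ℝ} (hκ : α * L ≤ κ) :
    IsLocalMin (P.penalty κ) xbar := by
  obtain ⟨hx, hmin⟩ := hopt
  obtain ⟨ε, hε, hEB⟩ := hEB
  obtain ⟨δ', hδ', hmin⟩ := Metric.eventually_nhds_iff_ball.1 (eventually_nhdsWithin_iff.1 hmin)
  -- The projection can be twice as far from `xbar` as `x` is, hence the halving.
  have hη : 0 < min ε (min δ δ' / 2) := lt_min hε (half_pos (lt_min hδ hδ'))
  filter_upwards [Metric.ball_mem_nhds xbar hη] with x hxη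
  rw [Metric.mem_ball, lt_min_iff, lt_div_iff₀ two_pos, lt_min_iff] at hxη
  obtain ⟨z, hz, hzd⟩ := P.isClosed_feasible.exists_infDist_eq_dist ⟨xbar, hx⟩ x
  have h1 : dist x z ≤ dist x xbar := hzd ▸ Metric.infDist_le_dist_of_mem hx
  have h2 : dist z xbar ≤ dist x xbar * 2 := by
    have := dist_triangle_left z xbar x
    linarith
  have h3 : P.f xbar ≤ P.f z := hmin z (h2.trans_lt hxη.2.2) hz
  have hxδ : x ∈ Metric.ball xbar δ := by
    rw [Metric.mem_ball]
    linarith [dist_nonneg (x := x) (y := xbar), hxη.2.1]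
  have h4 := hL.dist_le_mul z (h2.trans_lt hxη.2.1) x hxδ
  have h5 : P.f z - P.f x ≤ L * dist x z := by
    rw [dist_comm x z]
    exact (le_abs_self _).trans h4
  have h6 : dist x z ≤ α * P.residual x := hzd ▸ hEB x hxη.1
  have h7 : L * dist x z ≤ κ * P.residual x :=
    calc (L : ℝ) * dist x z ≤ L * (α * P.residual x) := mul_le_mul_of_nonneg_left h6 L.2
      _ = α * L * P.residual x := by ring
      _ ≤ _ := mul_le_mul_of_nonneg_right hκ (P.residual_nonneg x)
  simp only [penalty, residual_eq_zero hx]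
  linarith

theorem IsLocallyOptimal.localExactPenalization (hopt : P.IsLocallyOptimal xbar)
    (hEB : P.LocalErrorBound xbar) : P.LocalExactPenalization xbar := by
  obtain ⟨α, hα, hEB⟩ := hEB
  obtain ⟨L, s, hs, hL⟩ :=
    (P.contDiff_f.hasStrictFDerivAt (x := xbar) two_ne_zero).exists_lipschitzOnWith
  obtain ⟨δ, hδ, hδs⟩ := Metric.mem_nhds_iff.1 hs
  -- `L` may be 0; the added 1 keeps the threshold positive.
  refine ⟨α * L + 1, by positivity, fun κ hκ =>
    hopt.isLocalMin_penalty hEB hδ (hL.mono hδs) (by linarith)⟩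

end MPSC

theorem theorem6p3 {n m p l : ℕ} (P : MPSC n m p l) (xbar : EuclideanSpace ℝ (Fin n))
    (hx : xbar ∈ P.feasible) (hP : P.PCRSC xbar) :
    P.LocalErrorBound xbar ∧
    (P.IsLocallyOptimal xbar →
      P.LocalExactPenalization xbar ∧
      ∀ α > 0, P.LocalErrorBoundWith xbar α →
        ∀ L : ℝ≥0, (∃ δ > 0, LipschitzOnWith L P.f (Metric.ball xbar δ)) →
          ∀ κ > α * (L : ℝ), IsLocalMin (P.penalty κ) xbar) := by
  have hEB := hP.localErrorBound hx
  refine ⟨hEB, fun hopt => ⟨hopt.localExactPenalization hEB, ?_⟩⟩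
  rintro α - hα' L ⟨δ, hδ, hL⟩ κ hκ
  exact hopt.isLocalMin_penalty hα' hδ hL hκ.le
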